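/- Let $m \in \mathbb{N}$ (with $m=0$ allowed), let $\mathbb{T}$ be the circle group, let $F$ be a finite abelian group with the discrete topology, and let $r\colon F\times\mathbb{T}^m\to H$ be a continuous surjective group homomorphism onto a compact Hausdorff topological group $H$. Then there are a finite abelian group $F'$ (with the discrete topology) of order $|F'|\le |F|$ and an integer $n$ with $0 \le n\le m$ such that $H\cong F'\times\mathbb{T}^n$ as topological groups. Moreover, whenever $H\cong F'\times\mathbb{T}^n$ as topological groups with $F'$ a finite discrete abelian group and $n \ge 0$ an integer, one has $n=m$ if and only if the kernel of $r$ is finite. -/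

import Mathlib

/-! Restrict `r` to the torus and pull back along `exp` to `ℝ^m`. The kernel `L` is closed and
contains `2πℤ^m`, so it spans; modulo its largest linear subspace it is a lattice, and the image of
the torus is a torus `𝕋ⁿ` with `n ≤ m`. This image is closed of index at most `|F|`, hence open. As
`𝕋ⁿ` is divisible, it splits off algebraically, and openness makes the retraction continuous; the
complement is the finite factor.

If `n = m`, no line lies in `L` and the kernel is finite. Conversely, a surjection with finite
kernel preserves the number of `p`-torsion points for large primes `p`, and these numbers are `p ^
m` and `p ^ n`. The same count shows that `H` determines `n`. -/

/-! ### Closed subgroups of real vector spaces. -/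

theorem AddSubgroup.discreteTopology_of_isClosed_of_forall_line {E : Type*}
    [NormedAddCommGroup E] [NormedSpace ℝ E] [FiniteDimensional ℝ E] (L : AddSubgroup E)
    (hL : IsClosed (L : Set E)) (hline : ∀ x, (∀ t : ℝ, t • x ∈ L) → x = 0) :
    DiscreteTopology L := by
  have key : ∃ ε > 0, ∀ x ∈ L, ‖x‖ < ε → x = 0 := by
    by_contra! hcon
    choose x hxL hxlt hx0 using fun n : ℕ => hcon (1 / ((n : ℝ) + 1)) (by positivity)
    have : ProperSpace E := FiniteDimensional.proper ℝ E
    have hsph : ∀ n, ‖x n‖⁻¹ • x n ∈ Metric.sphere (0 : E) 1 := fun n => by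
      simp [norm_smul, hx0 n]
    obtain ⟨u, hu, φ, hφ, hlim⟩ := (isCompact_sphere (0 : E) 1).tendsto_subseq hsph
    have hx : Filter.Tendsto (fun n => ‖x (φ n)‖) Filter.atTop (nhds 0) := by
      refine (squeeze_zero (fun n => norm_nonneg _) (fun n => (hxlt n).le)
        tendsto_one_div_add_atTop_nhds_zero_nat).comp hφ.tendsto_atTop
    refine one_ne_zero (α := ℝ) ?_
    rw [← mem_sphere_zero_iff_norm.1 hu, hline u, norm_zero]
    intro t
    -- Integer multiples of the short vectors `x (φ n)` approximate `t • u` to within `‖x (φ n)‖`,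
    -- so the closed group `L` contains the line through `u`.
    have hcoef : Filter.Tendsto (fun n => (⌊t / ‖x (φ n)‖⌋ : ℝ) * ‖x (φ n)‖) Filter.atTop
        (nhds t) := by
      rw [tendsto_iff_dist_tendsto_zero]
      refine squeeze_zero (fun n => dist_nonneg) (fun n => ?_) hx
      have hpos : 0 < ‖x (φ n)‖ := norm_pos_iff.2 (hx0 _)
      have h1 := Int.floor_le (t / ‖x (φ n)‖)
      have h2 := (Int.lt_floor_add_one (t / ‖x (φ n)‖)).le
      rw [le_div_iff₀ hpos] at h1
      rw [div_le_iff₀ hpos, add_mul, one_mul] at h2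
      rw [Real.dist_eq, abs_le]
      constructor <;> linarith
    refine hL.mem_of_tendsto (hcoef.smul hlim) (Filter.Eventually.of_forall fun n => ?_)
    have hne : ‖x (φ n)‖ ≠ 0 := norm_ne_zero_iff.2 (hx0 _)
    rw [Function.comp_apply, smul_smul, mul_assoc, mul_inv_cancel₀ hne, mul_one,
      Int.cast_smul_eq_zsmul]
    exact L.zsmul_mem (hxL _) _
  obtain ⟨ε, hε, h⟩ := key
  refine discreteTopology_of_isOpen_singleton_zero ?_
  rw [Metric.isOpen_singleton_iff]
  refine ⟨ε, hε, fun y hy => Subtype.ext (h y y.2 ?_)⟩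
  simpa [dist_eq_norm] using hy

theorem AddSubgroup.exists_linearMap_mem_iff_of_isClosed {E : Type*}
    [NormedAddCommGroup E] [NormedSpace ℝ E] [FiniteDimensional ℝ E] (L : AddSubgroup E)
    (hL : IsClosed (L : Set E)) (hspan : Submodule.span ℝ (L : Set E) = ⊤) :
    ∃ (n : ℕ) (φ : E →ₗ[ℝ] (Fin n → ℝ)), Function.Surjective φ ∧
      ∀ x, x ∈ L ↔ ∀ i, ∃ k : ℤ, (k : ℝ) = φ x i := by
  -- `V` is the largest subspace inside `L`; on a complement `W`, `L` contains no line and is a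
  -- lattice, whose ℤ-basis gives the coordinates.
  let V : Submodule ℝ E :=
    { carrier := {x | ∀ t : ℝ, t • x ∈ L}
      add_mem' := fun ha hb t => by rw [smul_add]; exact L.add_mem (ha t) (hb t)
      zero_mem' := fun t => by rw [smul_zero]; exact L.zero_mem
      smul_mem' := fun c x hx t => by rw [smul_smul]; exact hx _ }
  have hVL : ∀ x ∈ V, x ∈ L := fun x hx => by simpa using hx 1
  obtain ⟨W, hVW⟩ := V.exists_isCompl
  let p : E →ₗ[ℝ] W := W.projectionOnto V hVW.symm
  have hp : ∀ x, x - p x ∈ V := fun x => by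
    have : p (x - p x) = 0 := by
      rw [map_sub, Submodule.projectionOnto_apply_left, sub_self]
    rwa [← LinearMap.mem_ker, Submodule.ker_projectionOnto] at this
  have hpL : ∀ x, x ∈ L ↔ (p x : E) ∈ L := fun x => by
    rw [← L.add_mem_cancel_left (hVL _ (hp x)) (y := (p x : E)), sub_add_cancel]
  let L₀ : AddSubgroup W := L.comap W.subtype.toAddMonoidHom
  have hdisc : DiscreteTopology L₀ := by
    refine L₀.discreteTopology_of_isClosed_of_forall_line
      (hL.preimage continuous_subtype_val) fun x hx => ?_
    have hxV : (x : E) ∈ V := fun t => hx t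
    exact Subtype.ext ((Submodule.disjoint_def.1 hVW.disjoint) _ hxV x.2)
  let L₁ : Submodule ℤ W := L₀.toIntSubmodule
  have : DiscreteTopology L₁ := hdisc
  have : IsZLattice ℝ L₁ := ⟨by
    have hsub : p '' (L : Set E) ⊆ (L₁ : Set W) := by
      rintro _ ⟨x, hx, rfl⟩
      exact (hpL x).1 hx
    refine top_unique (le_trans ?_ (Submodule.span_mono hsub))
    rw [Submodule.span_image, hspan, Submodule.map_top, Submodule.range_projectionOnto]⟩
  have := ZLattice.module_free ℝ L₁
  let b := Module.Free.chooseBasis ℤ L₁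
  let B := b.ofZLatticeBasis ℝ L₁
  let e := B.indexEquiv (Module.finBasis ℝ W)
  refine ⟨_, (B.reindex e).equivFun.toLinearMap ∘ₗ p, ?_, fun x => ?_⟩
  · rw [LinearMap.coe_comp]
    exact (B.reindex e).equivFun.surjective.comp (W.projectionOnto_surjective hVW.symm)
  · rw [hpL]
    have h1 : (p x : E) ∈ L ↔ p x ∈ Submodule.span ℤ (Set.range B) := by
      rw [b.ofZLatticeBasis_span ℝ L₁]; rfl
    rw [h1, ← B.range_reindex e, (B.reindex e).mem_span_iff_repr_mem ℤ]
    rfl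

/-! ### Counting torsion. -/

theorem Circle.card_pow_eq_one (p : ℕ) [NeZero p] : Nat.card {z : Circle // z ^ p = 1} = p := by
  refine Eq.trans ?_
    ((Nat.card_congr (rootsOfUnityCircleEquiv p).toEquiv).trans (Complex.card_rootsOfUnity p))
  refine Nat.card_congr (_root_.toUnits.toEquiv.subtypeEquiv fun z => ?_)
  simp [mem_rootsOfUnity, ← map_pow]

theorem card_pow_eq_one_prod_pi_circle {F : Type*} [CommGroup F] [Finite F] (m p : ℕ)
    [NeZero p] (hp : (Nat.card F).Coprime p) :
    Nat.card {x : F × (Fin m → Circle) // x ^ p = 1} = p ^ m := by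
  have hF : ∀ f : F, f ^ p = 1 → f = 1 := fun f hf =>
    (powCoprime hp).injective (by simpa using hf)
  let e : {x : F × (Fin m → Circle) // x ^ p = 1} ≃ (Fin m → {z : Circle // z ^ p = 1}) :=
    { toFun := fun x i => ⟨x.1.2 i, congrFun (congrArg Prod.snd x.2) i⟩
      invFun := fun y => ⟨(1, fun i => (y i).1), Prod.ext (one_pow p) (funext fun i => (y i).2)⟩
      left_inv := fun x => Subtype.ext
        (Prod.ext (hF _ (congrArg Prod.fst x.2)).symm rfl)
      right_inv := fun y => rfl }
  rw [Nat.card_congr e, Nat.card_fun, Circle.card_pow_eq_one, Nat.card_fin]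

/-- The `p`-th power map is bijective on the kernel: injectivity there separates torsion points,
surjectivity corrects a lift to a torsion point. -/
theorem MonoidHom.card_pow_eq_one_of_surjective {G H : Type*} [CommGroup G] [Group H]
    (f : G →* H) (hf : Function.Surjective f) [Finite f.ker] (p : ℕ)
    (hp : (Nat.card f.ker).Coprime p) :
    Nat.card {x : G // x ^ p = 1} = Nat.card {y : H // y ^ p = 1} := by
  refine Nat.card_congr (Equiv.ofBijective
    (fun x => ⟨f x.1, by rw [← map_pow, x.2, map_one]⟩) ⟨fun x y hxy => ?_, fun y => ?_⟩)
  · have hxy' : f x.1 = f y.1 := congrArg Subtype.val hxy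
    have hk : x.1 / y.1 ∈ f.ker := by rw [MonoidHom.mem_ker, map_div, hxy', div_self']
    have : (⟨x.1 / y.1, hk⟩ : f.ker) = 1 :=
      (powCoprime hp).injective (Subtype.ext (by simp [div_pow, x.2, y.2]))
    exact Subtype.ext (div_eq_one.1 (congrArg Subtype.val this))
  · obtain ⟨g, hg⟩ := hf y.1
    have hk : g ^ p ∈ f.ker := by rw [MonoidHom.mem_ker, map_pow, hg, y.2]
    obtain ⟨⟨k, hkk⟩, hk'⟩ := (powCoprime hp).surjective ⟨g ^ p, hk⟩
    have hkp : k ^ p = g ^ p := congrArg Subtype.val hk'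
    refine ⟨⟨g / k, by rw [div_pow, hkp, div_self']⟩, Subtype.ext ?_⟩
    change f (g / k) = y.1
    rw [map_div, hg, MonoidHom.mem_ker.1 hkk, div_one]

theorem eq_of_surjective_of_finite_ker {F F' : Type*} [CommGroup F] [Finite F] [CommGroup F']
    [Finite F'] {m n : ℕ} (f : F × (Fin m → Circle) →* F' × (Fin n → Circle))
    (hf : Function.Surjective f) (hker : Finite f.ker) : n = m := by
  obtain ⟨p, hp, hprime⟩ :=
    Nat.exists_infinite_primes (Nat.card F + Nat.card F' + Nat.card f.ker + 1)
  have hcop : ∀ k, 0 < k → k < p → k.Coprime p := fun k hk hkp =>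
    (Nat.coprime_of_lt_prime hk.ne' hkp hprime).symm
  have : NeZero p := ⟨hprime.ne_zero⟩
  have h := f.card_pow_eq_one_of_surjective hf p (hcop _ Nat.card_pos (by lia))
  rw [card_pow_eq_one_prod_pi_circle m p (hcop _ Nat.card_pos (by lia)),
    card_pow_eq_one_prod_pi_circle n p (hcop _ Nat.card_pos (by lia))] at h
  exact (Nat.pow_right_injective hprime.two_le h).symm

/-! ### Images of tori. -/

theorem Circle.isOpenQuotientMap_exp : IsOpenQuotientMap Circle.exp :=
  ⟨Circle.exp_surjective, Circle.exp.continuous, isLocalHomeomorph_circleExp.isOpenMap⟩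

theorem LinearMap.isOpenQuotientMap_of_finiteDimensional {E F : Type*}
    [NormedAddCommGroup E] [NormedSpace ℝ E] [FiniteDimensional ℝ E]
    [NormedAddCommGroup F] [NormedSpace ℝ F] [FiniteDimensional ℝ F]
    (f : E →ₗ[ℝ] F) (hf : Function.Surjective f) : IsOpenQuotientMap f :=
  ⟨hf, f.continuous_of_finiteDimensional, f.isOpenMap_of_finiteDimensional hf⟩

/-- The group homomorphism `E → 𝕋ⁿ` given by exponentiating a linear map `E → ℝⁿ`. -/
noncomputable def LinearMap.circleExp {E : Type*} [AddCommGroup E] [Module ℝ E] {n : ℕ}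
    (φ : E →ₗ[ℝ] (Fin n → ℝ)) : Multiplicative E →* (Fin n → Circle) where
  toFun x i := Circle.exp (φ x.toAdd i)
  map_one' := by ext; simp
  map_mul' x y := by ext; simp [Circle.exp_add]

theorem LinearMap.finite_setOf_forall_exists_int_of_injective {E : Type*}
    [NormedAddCommGroup E] [NormedSpace ℝ E] [FiniteDimensional ℝ E] {n : ℕ}
    (φ : E →ₗ[ℝ] (Fin n → ℝ)) (hφ : Function.Injective φ) (R : ℝ) :
    {x | ‖x‖ ≤ R ∧ ∀ i, ∃ k : ℤ, (k : ℝ) = φ x i}.Finite := by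
  let Φ : E →L[ℝ] (Fin n → ℝ) := φ.toContinuousLinearMap
  let N : ℤ := ⌈‖Φ‖ * R⌉
  refine (((Set.finite_Icc (fun _ : Fin n => -N) (fun _ => N)).image
    (fun k i => (k i : ℝ))).preimage hφ.injOn).subset ?_
  rintro x ⟨hx, hk⟩
  choose k hk using hk
  have hle : ∀ i, |(k i : ℝ)| ≤ (N : ℝ) := fun i => by
    rw [hk i]
    calc |φ x i| ≤ ‖Φ x‖ := norm_le_pi_norm (Φ x) i
      _ ≤ ‖Φ‖ * R := Φ.le_opNorm_of_le hx
      _ ≤ N := Int.le_ceil _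
  refine ⟨k, ⟨fun i => ?_, fun i => ?_⟩, funext hk⟩
  · exact_mod_cast (abs_le.1 (hle i)).1
  · exact_mod_cast (abs_le.1 (hle i)).2

theorem exists_injective_torus_hom_range_eq {H : Type*} [Group H] [TopologicalSpace H] [T2Space H]
    {m : ℕ} (ρ : (Fin m → Circle) →* H) (hρ : Continuous ρ) :
    ∃ (n : ℕ) (σ : (Fin n → Circle) →* H), n ≤ m ∧ Continuous σ ∧ Function.Injective σ ∧
      σ.range = ρ.range ∧ (n = m → Finite ρ.ker) := by
  let ε : Multiplicative (Fin m → ℝ) →* (Fin m → Circle) := LinearMap.id.circleExp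
  have hε : IsOpenQuotientMap (fun x : Fin m → ℝ => ε (.ofAdd x)) :=
    IsOpenQuotientMap.piMap fun _ => Circle.isOpenQuotientMap_exp
  let L : AddSubgroup (Fin m → ℝ) := (ρ.comp ε).ker.toAddSubgroup'
  have hLmem : ∀ x, x ∈ L ↔ ρ (ε (.ofAdd x)) = 1 := fun x => Iff.rfl
  have hLclosed : IsClosed (L : Set (Fin m → ℝ)) :=
    isClosed_singleton.preimage (hρ.comp hε.continuous)
  have hspan : Submodule.span ℝ (L : Set (Fin m → ℝ)) = ⊤ := by
    rw [eq_top_iff, ← (Pi.basisFun ℝ (Fin m)).span_eq, Submodule.span_le]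
    rintro _ ⟨i, rfl⟩
    have hmem : Pi.single i (2 * Real.pi) ∈ L := by
      have h1 : ε (.ofAdd (Pi.single i (2 * Real.pi))) = 1 := by
        funext j
        change Circle.exp (Pi.single (M := fun _ => ℝ) i (2 * Real.pi) j) = 1
        by_cases hij : j = i
        · subst hij; simp
        · simp [hij]
      rw [hLmem, h1, map_one]
    have := Submodule.smul_mem _ (2 * Real.pi)⁻¹ (Submodule.subset_span (R := ℝ) hmem)
    rwa [← Pi.single_smul, smul_eq_mul, inv_mul_cancel₀ Real.two_pi_pos.ne',
      ← Pi.basisFun_apply] at this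
  obtain ⟨n, φ, hφ, hφL⟩ := L.exists_linearMap_mem_iff_of_isClosed hLclosed hspan
  have hφ' : Function.Surjective ((2 * Real.pi) • φ) := fun y => by
    obtain ⟨x, hx⟩ := hφ ((2 * Real.pi)⁻¹ • y)
    exact ⟨x, by rw [LinearMap.smul_apply, hx, smul_inv_smul₀ Real.two_pi_pos.ne']⟩
  let ψ : Multiplicative (Fin m → ℝ) →* (Fin n → Circle) := ((2 * Real.pi) • φ).circleExp
  have hψ : IsOpenQuotientMap (fun x : Fin m → ℝ => ψ (.ofAdd x)) :=
    (IsOpenQuotientMap.piMap fun _ => Circle.isOpenQuotientMap_exp).comp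
      (LinearMap.isOpenQuotientMap_of_finiteDimensional _ hφ')
  have hker : ∀ x, ψ x = 1 ↔ ρ (ε x) = 1 := fun x => by
    refine Iff.trans ?_ (hφL x.toAdd).symm
    rw [funext_iff]
    refine forall_congr' fun i => ?_
    change Circle.exp (2 * Real.pi * φ x.toAdd i) = 1 ↔ _
    rw [Circle.exp_eq_one]
    refine exists_congr fun k => ?_
    rw [mul_comm, mul_left_inj' Real.two_pi_pos.ne', eq_comm]
  let σ : (Fin n → Circle) →* H :=
    ψ.liftOfSurjective hψ.surjective ⟨ρ.comp ε, fun x hx => (hker x).1 hx⟩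
  have hσ : ∀ x, σ (ψ x) = ρ (ε x) := ψ.liftOfRightInverse_comp_apply _ _ _
  have hrank : n ≤ m := by
    simpa using LinearMap.finrank_le_finrank_of_surjective hφ
  refine ⟨n, σ, hrank, ?_, ?_, ?_, ?_⟩
  · refine hψ.continuous_comp_iff.1 ((hρ.comp hε.continuous).congr fun x => ?_)
    exact (hσ _).symm
  · rw [injective_iff_map_eq_one]
    intro y hy
    obtain ⟨x, rfl⟩ := hψ.surjective y
    rw [hσ] at hy
    exact (hker _).2 hy
  · ext h
    constructor
    · rintro ⟨y, rfl⟩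
      obtain ⟨x, rfl⟩ := hψ.surjective y
      exact ⟨_, (hσ _).symm⟩
    · rintro ⟨y, rfl⟩
      obtain ⟨x, rfl⟩ := hε.surjective y
      exact ⟨_, hσ _⟩
  · rintro rfl
    -- Arguments lift `ker ρ` to points of `L` of sup norm at most `π`; with `φ` injective these are
    -- finitely many.
    have hinj := LinearMap.injective_iff_surjective.2 hφ
    refine Set.Finite.subset ((φ.finite_setOf_forall_exists_int_of_injective hinj
      Real.pi).image fun x => ε (.ofAdd x)) fun z hz => ?_
    have hz' : ε (.ofAdd fun i => (z i : ℂ).arg) = z := funext fun i => Circle.exp_arg (z i)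
    refine ⟨fun i => (z i : ℂ).arg, ⟨?_, ?_⟩, hz'⟩
    · exact (pi_norm_le_iff_of_nonneg Real.pi_pos.le).2 fun i => Complex.abs_arg_le_pi _
    · rw [← hφL, hLmem, hz']
      exact hz

/-! ### Splitting off the torus. -/

theorem Circle.exists_zpow_eq {k : ℤ} (hk : k ≠ 0) (z : Circle) : ∃ w : Circle, w ^ k = z := by
  obtain ⟨x, rfl⟩ := Circle.exp_surjective z
  refine ⟨Circle.exp (x / k), ?_⟩
  have h := map_zsmul Circle.expHom k (x / k)
  rw [zsmul_eq_mul, mul_div_cancel₀ x (Int.cast_ne_zero.2 hk)] at h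
  exact (congrArg Additive.toMul h).symm

theorem exists_leftInverse_hom_of_injective_torus_hom {H : Type*} [CommGroup H] {n : ℕ}
    (σ : (Fin n → Circle) →* H) (hσ : Function.Injective σ) :
    ∃ τ : H →* (Fin n → Circle), ∀ x, τ (σ x) = x := by
  let _ : DivisibleBy (Additive (Fin n → Circle)) ℤ :=
    divisibleByOfSMulRightSurj _ _ fun {k} hk x => by
      choose w hw using fun i => Circle.exists_zpow_eq hk (x.toMul i)
      exact ⟨.ofMul w, congrArg Additive.ofMul (funext hw)⟩
  obtain ⟨τ, hτ⟩ := (Module.Baer.of_divisible (Additive (Fin n → Circle))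
    ).extension_property_addMonoidHom (MonoidHom.toAdditive σ) hσ (AddMonoidHom.id _)
  exact ⟨MonoidHom.toAdditive.symm τ, fun x => DFunLike.congr_fun hτ (Additive.ofMul x)⟩

theorem exists_continuousMulEquiv_prod_torus {H : Type*} [CommGroup H] [TopologicalSpace H]
    [IsTopologicalGroup H] [T2Space H] {n : ℕ} (σ : (Fin n → Circle) →* H) (hσ : Continuous σ)
    (hinj : Function.Injective σ) [σ.range.FiniteIndex] :
    ∃ K : Subgroup H, Finite K ∧ Nat.card K ≤ σ.range.index ∧
      Nonempty (H ≃ₜ* K × (Fin n → Circle)) := by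
  obtain ⟨τ, hτ⟩ := exists_leftInverse_hom_of_injective_torus_hom σ hinj
  have hopen : IsOpen (σ.range : Set H) :=
    σ.range.isOpen_of_isClosed_of_finiteIndex (isCompact_range hσ).isClosed
  have hemb : Topology.IsOpenEmbedding σ := ⟨(hσ.isClosedEmbedding hinj).isEmbedding, hopen⟩
  have hτc : Continuous τ := by
    -- Near `1`, `τ` is the inverse of the open embedding `σ`.
    refine continuous_of_continuousAt_one τ ?_
    rw [← map_one σ, ← hemb.continuousAt_iff]
    exact continuousAt_id.congr (Filter.Eventually.of_forall fun x => (hτ x).symm)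
  have hKinj : Function.Injective fun k : τ.ker => (k.1 : H ⧸ σ.range) := by
    intro k l hkl
    obtain ⟨x, hx⟩ := QuotientGroup.eq.1 hkl
    have h1 := congrArg τ hx
    rw [hτ, map_mul, map_inv, MonoidHom.mem_ker.1 k.2, MonoidHom.mem_ker.1 l.2, inv_one,
      one_mul] at h1
    rw [h1, map_one, eq_comm, inv_mul_eq_one] at hx
    exact Subtype.ext hx
  have hmem : ∀ h, h / σ (τ h) ∈ τ.ker := fun h => by
    rw [MonoidHom.mem_ker, map_div, hτ, div_self']
  refine ⟨τ.ker, Finite.of_injective _ hKinj, Nat.card_le_card_of_injective _ hKinj, ⟨?_⟩⟩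
  exact
    { toFun := fun h => (⟨h / σ (τ h), hmem h⟩, τ h)
      invFun := fun x => x.1.1 * σ x.2
      left_inv := fun h => div_mul_cancel h _
      right_inv := fun x => by
        have h1 : τ (x.1.1 * σ x.2) = x.2 := by
          rw [map_mul, MonoidHom.mem_ker.1 x.1.2, hτ, one_mul]
        refine Prod.ext (Subtype.ext ?_) h1
        change x.1.1 * σ x.2 / σ (τ (x.1.1 * σ x.2)) = x.1.1
        rw [h1, mul_div_cancel_right]
      map_mul' := fun x y => by
        refine Prod.ext (Subtype.ext ?_) (map_mul τ x y)
        change x * y / σ (τ (x * y)) = x / σ (τ x) * (y / σ (τ y))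
        rw [map_mul, map_mul, mul_div_mul_comm]
      continuous_toFun :=
        (Continuous.subtype_mk (continuous_id.div' (hσ.comp hτc)) hmem).prodMk hτc
      continuous_invFun := by fun_prop }

theorem exists_finite_prod_torus_of_surjective {F H : Type*} (m : ℕ)
    [CommGroup F] [Finite F] [TopologicalSpace F]
    [CommGroup H] [TopologicalSpace H] [IsTopologicalGroup H] [T2Space H]
    (r : F × (Fin m → Circle) →* H) (hr_cont : Continuous r)
    (hr_surj : Function.Surjective r) :
    ∃ (K : Subgroup H) (n : ℕ), Finite K ∧ Nat.card K ≤ Nat.card F ∧ n ≤ m ∧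
      Nonempty (H ≃ₜ* K × (Fin n → Circle)) ∧ (n = m → Finite r.ker) := by
  let ρ : (Fin m → Circle) →* H := r.comp (MonoidHom.inr _ _)
  obtain ⟨n, σ, hnm, hσ, hinj, hrange, hfin⟩ := exists_injective_torus_hom_range_eq ρ
    (hr_cont.comp (continuous_const.prodMk continuous_id))
  have hsurj : Function.Surjective fun f : F => (r (f, 1) : H ⧸ σ.range) := by
    intro y
    obtain ⟨h, rfl⟩ := QuotientGroup.mk_surjective y
    obtain ⟨⟨f, t⟩, rfl⟩ := hr_surj h
    refine ⟨f, QuotientGroup.eq.2 ?_⟩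
    rw [hrange, ← map_inv, ← map_mul]
    exact ⟨t, congrArg r (by simp)⟩
  have : Finite (H ⧸ σ.range) := Finite.of_surjective _ hsurj
  have : σ.range.FiniteIndex := Subgroup.finiteIndex_of_finite_quotient
  obtain ⟨K, hK, hcard, e⟩ := exists_continuousMulEquiv_prod_torus σ hσ hinj
  refine ⟨K, n, hK, hcard.trans (Nat.card_le_card_of_surjective _ hsurj), hnm, e, fun hn => ?_⟩
  -- Each fibre of `r.ker` over `F` is a translate of `ρ.ker`.
  have : Finite ρ.ker := hfin hn
  refine Set.Finite.of_finite_fibers Prod.fst (Set.toFinite _) ?_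
  rintro _ ⟨⟨f, t₀⟩, h₀, rfl⟩
  refine ((Set.toFinite (ρ.ker : Set (Fin m → Circle))).image fun t => (f, t₀ * t)).subset ?_
  rintro ⟨f', t⟩ ⟨h, hf⟩
  obtain rfl : f' = f := hf
  refine ⟨t₀⁻¹ * t, ?_, by simp⟩
  have h1 := r.ker.mul_mem (r.ker.inv_mem h₀) h
  change r _ = 1
  simpa [MonoidHom.mem_ker] using h1

theorem mainTheorem12 {F H : Type*} (m : ℕ)
    [CommGroup F] [Finite F] [TopologicalSpace F] [DiscreteTopology F]
    [Group H] [TopologicalSpace H] [IsTopologicalGroup H] [CompactSpace H] [T2Space H]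
    (r : F × (Fin m → Circle) →* H) (hr_cont : Continuous r)
    (hr_surj : Function.Surjective r) :
    (∃ (F' : Type) (_ : CommGroup F') (_ : Finite F') (_ : TopologicalSpace F')
        (_ : DiscreteTopology F') (n : ℕ),
        Nonempty (H ≃ₜ* F' × (Fin n → Circle)) ∧ Nat.card F' ≤ Nat.card F ∧ n ≤ m) ∧
    (∀ (F' : Type) [CommGroup F'] [Finite F'] [TopologicalSpace F'] [DiscreteTopology F']
        (n : ℕ), Nonempty (H ≃ₜ* F' × (Fin n → Circle)) →
        (n = m ↔ Finite r.ker)) := by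
  let _ : CommGroup H :=
    { ‹Group H› with
      mul_comm := fun a b => by
        obtain ⟨x, rfl⟩ := hr_surj a
        obtain ⟨y, rfl⟩ := hr_surj b
        rw [← map_mul, mul_comm, map_mul] }
  obtain ⟨K, n₀, hK, hcard, hn₀, ⟨e₀⟩, hfin⟩ :=
    exists_finite_prod_torus_of_surjective m r hr_cont hr_surj
  refine ⟨?_, fun F' _ _ _ _ n ⟨e⟩ => ⟨fun hn => hfin ?_, fun hker => ?_⟩⟩
  -- `K` lives in the universe of `H`; being finite, it has a copy in `Type`.
  · let _ : TopologicalSpace (Shrink.{0} K) := ⊥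
    have : DiscreteTopology (Shrink.{0} K) := ⟨rfl⟩
    have : Finite (Shrink.{0} K) := Finite.of_equiv _ (equivShrink.{0} K)
    let s : K ≃* Shrink.{0} K := Shrink.mulEquiv.symm
    let s' : K × (Fin n₀ → Circle) ≃ₜ* Shrink.{0} K × (Fin n₀ → Circle) :=
      { s.prodCongr (.refl _) with
        continuous_toFun := continuous_of_discreteTopology.prodMap continuous_id
        continuous_invFun := continuous_of_discreteTopology.prodMap continuous_id }
    exact ⟨Shrink.{0} K, inferInstance, inferInstance, inferInstance, inferInstance, n₀,
      ⟨e₀.trans s'⟩, (Nat.card_congr (equivShrink.{0} K)).ge.trans hcard, hn₀⟩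
  -- Comparing the given decomposition with the constructed one yields `n₀ = n`.
  · let f : F' × (Fin n → Circle) →* K × (Fin n₀ → Circle) :=
      (e.symm.trans e₀ : _ ≃ₜ* _).toMulEquiv.toMonoidHom
    have hf : Function.Bijective f := (e.symm.trans e₀).bijective
    have hker : Finite f.ker := by
      rw [(MonoidHom.ker_eq_bot_iff f).2 hf.injective]
      infer_instance
    exact (eq_of_surjective_of_finite_ker f hf.surjective hker).trans hn
  · refine eq_of_surjective_of_finite_ker (e.toMulEquiv.toMonoidHom.comp r)
      (e.surjective.comp hr_surj) ?_
    have : (e.toMulEquiv.toMonoidHom.comp r).ker = r.ker := by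
      ext x
      simp [MonoidHom.mem_ker]
    rwa [this]
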